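/- Let $d_1,d_2\ge 0$ and $1\le n<N$ be integers, let $\sigma>0$, and let $A_1,\dots,A_N\in\mathbb{R}^{d_1\times d_2}$ be real matrices with $\|A_i\|\le\sigma$ for all $i$, where $\|\cdot\|$ denotes the spectral norm. Put $\mu:=\frac1N\sum_{i=1}^N A_i$. Let $X_1,\dots,X_n$ be drawn uniformly at random without replacement from $A_1,\dots,A_N$, i.e. $X_i=A_{J_i}$, where $(J_1,\dots,J_n)$ is uniformly distributed over all sequences of $n$ pairwise distinct indices in $\{1,\dots,N\}$. Then, for every $\epsilon>0$, $$P\left(\left\|\frac1n\sum_{i=1}^n X_i-\mu\right\|\ge\epsilon\right)\le 2(d_1+d_2)\exp\left(-\frac{n\epsilon^2}{8\sigma^2(1+1/n)(1-n/N)}\right).$$ -/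

import Mathlib

open MeasureTheory
open scoped ENNReal

-- The norm of a (rectangular) real matrix is the spectral norm, i.e. the operator norm
-- between Euclidean spaces.
open scoped Matrix.Norms.L2Operator

/-- The random indices `J 0, …, J (n - 1)` form an (ordered) uniform sample of size `n` without
replacement from a population of `N` labelled items: every sequence of `n` pairwise distinct
indices is drawn with the same probability `1 / (N (N - 1) ⋯ (N - n + 1))`. -/
structure IsSampleWithoutReplacement {Ω : Type*} [MeasurableSpace Ω] (P : Measure Ω) {N n : ℕ}
    (J : Fin n → Ω → Fin N) : Prop where
  measurable : ∀ i, Measurable (J i)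
  prob_eq : ∀ f : Fin n ↪ Fin N,
    P {ω | ∀ i, J i ω = f i} = ((N.descFactorial n : ℕ) : ℝ≥0∞)⁻¹

/-!
The proof runs a matrix Hoeffding argument along a reverse martingale. For a sample of size `k`,
let `Y_k` be its mean minus the population mean. Removing a uniformly random item from a uniform
sample of size `k + 1` gives a uniform sample of size `k`, and changes the mean by a centred
increment of spectral norm at most `2 σ / k` (`sampleDeviation_comp_succAbove`,
`sum_removalIncrement`, `norm_removalIncrement_le`). Since `Y_N = 0`, the deviation `Y_n` is a sum
of `N - n` martingale increments, and the sum of `1 / k ^ 2` over `n ≤ k < N` is at most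
`(1 + 1 / n) (1 - n / N) / n` (`inv_sq_add_varianceProxy_succ_le`), which is the quantity in the
exponent. Running the martingale from the full population downwards, rather than adding items
one by one, is what yields this form of the finite-population factor for every `n < N`.

Rectangular matrices are replaced by their Hermitian dilations `H(A) = [[0, A], [Aᵀ, 0]]`, which
have the same norm. The quantity followed along the martingale is the mean of `tr exp (θ H(Y_k))`.
Each step multiplies it by at most `exp (c ^ 2 / 2)` with `c = 2 σ |θ| / k`: the Golden–Thompson
inequality `tr exp (H + D) ≤ tr (exp H * exp D)` (`trace_exp_add_le`) separates the increment, and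
`exp D ≤ cosh c + (sinh c / c) D` in the Loewner order whenever `‖D‖ ≤ c`, so the linear term
averages out (`sum_trace_exp_add_le`). As the increments are bounded in norm by scalars,
Golden–Thompson suffices and Lieb's concavity theorem is not needed. At `k = N` the trace is
`d₁ + d₂`. A Markov bound with `± θ`, which controls both ends of the spectrum of `H(Y_n)` and
accounts for the factor `2`, and the optimal choice of `θ` conclude.

Golden–Thompson itself follows from the Lie product formula (`tendsto_lie_product`) and from
`tr (X * Y) ^ r ≤ tr (X ^ r * Y ^ r)` for symmetric `X`, `Y` and `r` a power of two
(`trace_pow_two_pow_le`).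
-/

/-! ### Trace inequalities for powers of matrices -/

section TracePowers

variable {m : Type*} [Fintype m]

theorem trace_mul_self_le (M : Matrix m m ℝ) : (M * M).trace ≤ (M * M.conjTranspose).trace := by
  have h := (Matrix.posSemidef_self_mul_conjTranspose (M - M.conjTranspose)).trace_nonneg
  have h₁ : (M.conjTranspose * M.conjTranspose).trace = (M * M).trace := by
    rw [← Matrix.conjTranspose_mul, Matrix.trace_conjTranspose, star_trivial]
  simp only [Matrix.conjTranspose_sub, Matrix.conjTranspose_conjTranspose, sub_mul, mul_sub,
    Matrix.trace_sub, h₁, Matrix.trace_mul_comm M.conjTranspose M] at h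
  linarith

theorem two_mul_trace_mul_le {P Q : Matrix m m ℝ} (hP : P.IsHermitian) (hQ : Q.IsHermitian) :
    2 * (P * Q).trace ≤ (P * P).trace + (Q * Q).trace := by
  have h := (Matrix.posSemidef_self_mul_conjTranspose (P - Q)).trace_nonneg
  simp only [Matrix.conjTranspose_sub, hP.eq, hQ.eq, sub_mul, mul_sub,
    Matrix.trace_sub, Matrix.trace_mul_comm Q P] at h
  linarith

variable [DecidableEq m]

theorem trace_mul_pow_comm (A B : Matrix m m ℝ) (k : ℕ) :
    ((A * B) ^ k).trace = ((B * A) ^ k).trace := by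
  cases k with
  | zero => simp
  | succ k =>
    have h : SemiconjBy A (B * A) (A * B) := by simp [SemiconjBy, mul_assoc]
    rw [pow_succ, ← mul_assoc, ← (h.pow_right k).eq, Matrix.trace_mul_comm, ← mul_assoc,
      ← pow_succ']

/-- Two trace inequalities for powers of two, proved together because each one at level `j + 1`
uses both at level `j`: a Weyl-type bound for arbitrary `M`, and the comparison of `(X * Y) ^ r`
with `X ^ r * Y ^ r` for symmetric `X` and `Y`. -/
theorem trace_pow_two_pow_le (j : ℕ) :
    (∀ M : Matrix m m ℝ, (M ^ 2 ^ (j + 1)).trace ≤ ((M * M.conjTranspose) ^ 2 ^ j).trace) ∧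
    (∀ X Y : Matrix m m ℝ, X.IsHermitian → Y.IsHermitian →
      ((X * Y) ^ 2 ^ j).trace ≤ (X ^ 2 ^ j * Y ^ 2 ^ j).trace) := by
  induction j with
  | zero => exact ⟨fun M ↦ by simpa [pow_two] using trace_mul_self_le M, fun X Y _ _ ↦ by simp⟩
  | succ j ih =>
    obtain ⟨ihM, ihXY⟩ := ih
    have dbl (Z : Matrix m m ℝ) : Z ^ 2 ^ (j + 1) = (Z * Z) ^ 2 ^ j := by
      rw [← pow_two, ← pow_mul, pow_succ' 2 j]
    refine ⟨fun M ↦ ?_, fun X Y hX hY ↦ ?_⟩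
    -- With `P = M * Mᴴ` and `Q = Mᴴ * M`, the bounds at level `j` lead to `tr (P ^ r * Q ^ r)`,
    -- which is at most the mean of `tr P ^ (2 * r)` and `tr Q ^ (2 * r)`; these two traces agree.
    · have hP : (M * M.conjTranspose).IsHermitian := Matrix.isHermitian_mul_conjTranspose_self M
      have hQ : (M.conjTranspose * M).IsHermitian := Matrix.isHermitian_conjTranspose_mul_self M
      have h := two_mul_trace_mul_le (hP.pow (2 ^ j)) (hQ.pow (2 ^ j))
      rw [← pow_add, ← pow_add, ← two_mul, ← pow_succ', trace_mul_pow_comm M.conjTranspose M] at h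
      calc (M ^ 2 ^ (j + 1 + 1)).trace = ((M * M) ^ 2 ^ (j + 1)).trace := by
            rw [← pow_two, ← pow_mul, pow_succ' 2 (j + 1)]
        _ ≤ ((M * M * (M * M).conjTranspose) ^ 2 ^ j).trace := ihM _
        _ = ((M * M.conjTranspose * (M.conjTranspose * M)) ^ 2 ^ j).trace := by
            rw [Matrix.conjTranspose_mul, mul_assoc, trace_mul_pow_comm]
            simp only [mul_assoc]
        _ ≤ _ := ihXY _ _ hP hQ
        _ ≤ _ := by linarith
    · calc ((X * Y) ^ 2 ^ (j + 1)).trace ≤ ((X * Y * (X * Y).conjTranspose) ^ 2 ^ j).trace :=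
            ihM _
        _ = ((X * X * (Y * Y)) ^ 2 ^ j).trace := by
            rw [Matrix.conjTranspose_mul, hX.eq, hY.eq, ← mul_assoc, trace_mul_pow_comm]
            simp only [mul_assoc]
        _ ≤ _ := ihXY _ _ (by simpa [pow_two] using hX.pow 2) (by simpa [pow_two] using hY.pow 2)
        _ = _ := by rw [dbl, dbl]

end TracePowers

/-! ### The Lie product formula and the Golden–Thompson inequality -/

section LieProduct

open Filter Topology NormedSpace

theorem isHermitian_smul (r : ℝ) {m : Type*} {D : Matrix m m ℝ} (hD : D.IsHermitian) :
    (r • D).IsHermitian := by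
  rw [Matrix.IsHermitian, Matrix.conjTranspose_smul, hD.eq, star_trivial]

theorem norm_pow_succ_sub_pow_succ_le {R : Type*} [NormedRing R] {X Y : R} {C : ℝ}
    (hX : ‖X‖ ≤ C) (hY : ‖Y‖ ≤ C) (n : ℕ) :
    ‖X ^ (n + 1) - Y ^ (n + 1)‖ ≤ (n + 1) * C ^ n * ‖X - Y‖ := by
  have hC : 0 ≤ C := (norm_nonneg X).trans hX
  induction n with
  | zero => simp
  | succ n ih =>
    have hYn : ‖Y ^ (n + 1)‖ ≤ C ^ (n + 1) :=
      (norm_pow_le' Y n.succ_pos).trans (pow_le_pow_left₀ (norm_nonneg _) hY _)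
    calc ‖X ^ (n + 1 + 1) - Y ^ (n + 1 + 1)‖
        = ‖X * (X ^ (n + 1) - Y ^ (n + 1)) + (X - Y) * Y ^ (n + 1)‖ := by
          rw [pow_succ' X (n + 1), pow_succ' Y (n + 1)]; congr 1; noncomm_ring
      _ ≤ ‖X‖ * ‖X ^ (n + 1) - Y ^ (n + 1)‖ + ‖X - Y‖ * ‖Y ^ (n + 1)‖ :=
          (norm_add_le _ _).trans (add_le_add (norm_mul_le _ _) (norm_mul_le _ _))
      _ ≤ C * ((n + 1) * C ^ n * ‖X - Y‖) + ‖X - Y‖ * C ^ (n + 1) := by gcongr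
      _ = _ := by push_cast; ring

variable {m : Type*} [Fintype m] [DecidableEq m]

theorem abs_le_norm_of_mem_spectrum {D : Matrix m m ℝ} (hD : D.IsHermitian) {x : ℝ}
    (hx : x ∈ spectrum ℝ D) : |x| ≤ ‖D‖ := by
  have := norm_apply_le_norm_cfc (fun x : ℝ ↦ x) D hx (by fun_prop) hD.isSelfAdjoint
  rwa [cfc_id' ℝ D hD.isSelfAdjoint] at this

theorem norm_exp_le_of_isHermitian {A : Matrix m m ℝ} (hA : A.IsHermitian) :
    ‖exp A‖ ≤ Real.exp ‖A‖ := by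
  rw [← CFC.real_exp_eq_normedSpace_exp hA.isSelfAdjoint]
  refine norm_cfc_le (Real.exp_pos _).le fun x hx ↦ ?_
  rw [Real.norm_eq_abs, Real.abs_exp, Real.exp_le_exp]
  exact (le_abs_self x).trans (abs_le_norm_of_mem_spectrum hA hx)

/-- Both curves `t ↦ exp (t A) exp (t B)` and `t ↦ exp (t (A + B))` leave `1` with velocity
`A + B`, so they differ by `o(t)`. -/
theorem exp_smul_mul_exp_smul_sub_isLittleO (A B : Matrix m m ℝ) :
    (fun t : ℝ ↦ exp (t • A) * exp (t • B) - exp (t • (A + B))) =o[𝓝 0] fun t : ℝ ↦ t := by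
  have h : HasDerivAt (fun t : ℝ ↦ exp (t • A) * exp (t • B) - exp (t • (A + B))) 0 0 := by
    have h₁ := ((hasDerivAt_exp_smul_const A (0 : ℝ)).mul (hasDerivAt_exp_smul_const B (0 : ℝ))).sub
      (hasDerivAt_exp_smul_const (A + B) (0 : ℝ))
    exact h₁.congr_deriv (by simp)
  simpa using h.isLittleO

theorem tendsto_lie_product {A B : Matrix m m ℝ} (hA : A.IsHermitian) (hB : B.IsHermitian) :
    Tendsto (fun n : ℕ ↦ (exp ((n + 1 : ℝ)⁻¹ • A) * exp ((n + 1 : ℝ)⁻¹ • B)) ^ (n + 1))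
      atTop (𝓝 (exp (A + B))) := by
  set K := ‖A‖ + ‖B‖
  have hbd (n : ℕ) {D : Matrix m m ℝ} (hD : D.IsHermitian) :
      ‖exp ((n + 1 : ℝ)⁻¹ • D)‖ ≤ Real.exp ((n + 1 : ℝ)⁻¹ * ‖D‖) := by
    refine (norm_exp_le_of_isHermitian (isHermitian_smul _ hD)).trans_eq ?_
    rw [norm_smul, Real.norm_of_nonneg (by positivity)]
  have hlim : Tendsto (fun n : ℕ ↦ (n + 1 : ℝ)⁻¹) atTop (𝓝 0) := by
    simpa using tendsto_one_div_add_atTop_nhds_zero_nat (𝕜 := ℝ)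
  have ho := (exp_smul_mul_exp_smul_sub_isLittleO A B).comp_tendsto hlim
  have hratio := ho.norm_left.tendsto_div_nhds_zero.const_mul (Real.exp K)
  simp only [mul_zero, Function.comp_apply, div_inv_eq_mul] at hratio
  refine tendsto_iff_norm_sub_tendsto_zero.2 (squeeze_zero (fun _ ↦ norm_nonneg _) (fun n ↦ ?_)
    hratio)
  have hn : (0 : ℝ) < n + 1 := by positivity
  have hpow : exp (A + B) = exp ((n + 1 : ℝ)⁻¹ • (A + B)) ^ (n + 1) := by
    rw [← Matrix.exp_nsmul, ← Nat.cast_smul_eq_nsmul ℝ, smul_smul]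
    push_cast
    rw [mul_inv_cancel₀ hn.ne', one_smul]
  have h₁ : ‖exp ((n + 1 : ℝ)⁻¹ • A) * exp ((n + 1 : ℝ)⁻¹ • B)‖ ≤
      Real.exp ((n + 1 : ℝ)⁻¹ * K) := by
    refine (norm_mul_le _ _).trans ?_
    rw [mul_add, Real.exp_add]
    gcongr
    exacts [hbd n hA, hbd n hB]
  have h₂ : ‖exp ((n + 1 : ℝ)⁻¹ • (A + B))‖ ≤ Real.exp ((n + 1 : ℝ)⁻¹ * K) :=
    (hbd n (hA.add hB)).trans (by gcongr; exact norm_add_le _ _)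
  rw [hpow]
  refine (norm_pow_succ_sub_pow_succ_le h₁ h₂ n).trans ?_
  have h₃ : Real.exp ((n + 1 : ℝ)⁻¹ * K) ^ n ≤ Real.exp K := by
    rw [← Real.exp_nat_mul, Real.exp_le_exp, ← mul_assoc]
    refine mul_le_of_le_one_left (by positivity) ?_
    rw [← div_eq_mul_inv, div_le_one hn]
    linarith
  calc (n + 1 : ℝ) * Real.exp ((n + 1 : ℝ)⁻¹ * K) ^ n * _ ≤ (n + 1 : ℝ) * Real.exp K * _ := by
        gcongr
    _ = _ := by ring

/-- The **Golden–Thompson inequality** for real symmetric matrices. -/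
theorem trace_exp_add_le {A B : Matrix m m ℝ} (hA : A.IsHermitian) (hB : B.IsHermitian) :
    (exp (A + B)).trace ≤ (exp A * exp B).trace := by
  have hsub : Tendsto (fun j : ℕ ↦ 2 ^ j - 1) atTop atTop :=
    (tendsto_sub_atTop_nat 1).comp (tendsto_pow_atTop_atTop_of_one_lt one_lt_two)
  have hcont : Continuous fun M : Matrix m m ℝ ↦ M.trace := continuous_id.matrix_trace
  have hlim := (hcont.tendsto _).comp ((tendsto_lie_product hA hB).comp hsub)
  refine le_of_tendsto hlim (Eventually.of_forall fun j ↦ ?_)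
  have h1 : 2 ^ j - 1 + 1 = 2 ^ j := Nat.sub_add_cancel Nat.one_le_two_pow
  have h1' : ((2 ^ j - 1 : ℕ) : ℝ) + 1 = ((2 ^ j : ℕ) : ℝ) := by exact_mod_cast h1
  have hpow (D : Matrix m m ℝ) : exp (((2 ^ j : ℕ) : ℝ)⁻¹ • D) ^ 2 ^ j = exp D := by
    rw [← Matrix.exp_nsmul, ← Nat.cast_smul_eq_nsmul ℝ, smul_smul, mul_inv_cancel₀ (by positivity),
      one_smul]
  simp only [Function.comp_apply, h1, h1']
  refine ((trace_pow_two_pow_le j).2 _ _ (isHermitian_smul _ hA).exp (isHermitian_smul _ hB).exp).trans_eq ?_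
  rw [hpow, hpow]

end LieProduct

/-! ### Exponential moments of symmetric matrices -/

section ExponentialMoment

open NormedSpace

variable {m : Type*} [Fintype m] [DecidableEq m]

/-- The chord of the convex function `exp` over `[-c, c]` lies above its graph. For `c = 0` the
quotient `sinh c / c` is the junk value `0`, and the bound still holds. -/
theorem exp_le_cosh_add_sinh_div_mul {c x : ℝ} (hx : |x| ≤ c) :
    Real.exp x ≤ Real.cosh c + Real.sinh c / c * x := by
  rcases (abs_nonneg x |>.trans hx).eq_or_lt with rfl | hc
  · simp [abs_nonpos_iff.1 hx]
  obtain ⟨h₁, h₂⟩ := abs_le.1 hx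
  have ha : 0 ≤ (c - x) / (2 * c) := div_nonneg (by linarith) (by linarith)
  have hb : 0 ≤ (c + x) / (2 * c) := div_nonneg (by linarith) (by linarith)
  have h := convexOn_exp.2 (Set.mem_univ (-c)) (Set.mem_univ c) ha hb (by field_simp; ring)
  have hx' : ((c - x) / (2 * c)) • (-c) + ((c + x) / (2 * c)) • c = x := by
    simp only [smul_eq_mul]; field_simp; ring
  rw [hx'] at h
  refine h.trans_eq ?_
  rw [Real.cosh_eq, Real.sinh_eq]
  simp only [smul_eq_mul]
  field_simp
  ring

open scoped MatrixOrder in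
theorem posSemidef_chord_sub_exp {D : Matrix m m ℝ} (hD : D.IsHermitian) {c : ℝ} (hc : ‖D‖ ≤ c) :
    (Real.cosh c • (1 : Matrix m m ℝ) + (Real.sinh c / c) • D - exp D).PosSemidef := by
  have hD' := hD.isSelfAdjoint
  have h : cfc Real.exp D ≤ cfc (fun x : ℝ ↦ Real.cosh c + Real.sinh c / c * x) D :=
    cfc_mono fun x hx ↦
      exp_le_cosh_add_sinh_div_mul ((abs_le_norm_of_mem_spectrum hD hx).trans hc)
  rw [CFC.real_exp_eq_normedSpace_exp hD', cfc_const_add _ _ D, cfc_const_mul _ _ D,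
    cfc_id' ℝ D, Algebra.algebraMap_eq_smul_one] at h
  exact h

theorem posSemidef_exp {H : Matrix m m ℝ} (hH : H.IsHermitian) : (exp H).PosSemidef := by
  have hh : exp H = exp ((1 / 2 : ℝ) • H) * (exp ((1 / 2 : ℝ) • H)).conjTranspose := by
    rw [(isHermitian_smul _ hH).exp.eq, ← Matrix.exp_add_of_commute _ _ (Commute.refl _),
      ← add_smul]
    norm_num
  rw [hh]
  exact Matrix.posSemidef_self_mul_conjTranspose _

open scoped MatrixOrder in
theorem trace_mul_nonneg_of_posSemidef {P Q : Matrix m m ℝ} (hP : P.PosSemidef)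
    (hQ : Q.PosSemidef) : 0 ≤ (P * Q).trace := by
  obtain ⟨B, rfl⟩ := CStarAlgebra.nonneg_iff_eq_star_mul_self.mp hP.nonneg
  rw [Matrix.star_eq_conjTranspose, mul_assoc, Matrix.trace_mul_comm]
  exact (hQ.mul_mul_conjTranspose_same B).trace_nonneg

/-- The matrix form of Hoeffding's lemma: a symmetric perturbation with mean zero and spectral
norm at most `c` raises the mean of `tr exp` by a factor of at most `exp (c ^ 2 / 2)`. By
Golden–Thompson it is enough to bound `exp (D i)` by an affine function of `D i`, whose linear
part averages out. -/
theorem sum_trace_exp_add_le {ι : Type*} [Fintype ι] {H : Matrix m m ℝ} (hH : H.IsHermitian)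
    {D : ι → Matrix m m ℝ} (hD : ∀ i, (D i).IsHermitian) (hsum : ∑ i, D i = 0) {c : ℝ}
    (hc : ∀ i, ‖D i‖ ≤ c) :
    ∑ i, (exp (H + D i)).trace ≤ Fintype.card ι * (Real.exp (c ^ 2 / 2) * (exp H).trace) := by
  have htr : 0 ≤ (exp H).trace := (posSemidef_exp hH).trace_nonneg
  have hi (i : ι) : (exp (H + D i)).trace ≤
      Real.cosh c * (exp H).trace + Real.sinh c / c * (exp H * D i).trace := by
    have h := trace_mul_nonneg_of_posSemidef (posSemidef_exp hH)
      (posSemidef_chord_sub_exp (hD i) (hc i))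
    simp only [mul_sub, mul_add, Matrix.mul_smul, mul_one, Matrix.trace_sub, Matrix.trace_add,
      Matrix.trace_smul, smul_eq_mul] at h
    linarith [trace_exp_add_le hH (hD i)]
  calc ∑ i, (exp (H + D i)).trace
      ≤ ∑ i, (Real.cosh c * (exp H).trace + Real.sinh c / c * (exp H * D i).trace) :=
        Finset.sum_le_sum fun i _ ↦ hi i
    _ = Fintype.card ι * (Real.cosh c * (exp H).trace) := by
        rw [Finset.sum_add_distrib, Finset.sum_const, ← Finset.mul_sum, ← Matrix.trace_sum,
          ← Finset.mul_sum, hsum]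
        simp
    _ ≤ _ := by gcongr; exact Real.cosh_le_exp_half_sq c

theorem trace_exp_smul_eq_sum {H : Matrix m m ℝ} (hH : H.IsHermitian) (t : ℝ) :
    (exp (t • H)).trace = ∑ i, Real.exp (t * hH.eigenvalues i) := by
  have h : exp (t • H) = cfc (fun x : ℝ ↦ Real.exp (t * x)) H := by
    rw [← CFC.real_exp_eq_normedSpace_exp (isHermitian_smul t hH).isSelfAdjoint,
      ← cfc_comp_const_mul t Real.exp H (by fun_prop) hH.isSelfAdjoint]
  rw [h, hH.cfc_eq, Matrix.IsHermitian.cfc, Unitary.conjStarAlgAut_apply, Matrix.trace_mul_comm,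
    ← mul_assoc]
  simp [Matrix.trace_diagonal]

/-- The spectral norm of a symmetric matrix is attained, up to sign, at an eigenvalue, so it is
controlled by `tr exp` at two opposite parameters. -/
theorem exp_mul_norm_le_trace_exp_add {H : Matrix m m ℝ} (hH : H.IsHermitian) (hH0 : H ≠ 0)
    (t : ℝ) : Real.exp (t * ‖H‖) ≤ (exp (t • H)).trace + (exp ((-t) • H)).trace := by
  have : Nontrivial (Matrix m m ℝ) := ⟨⟨H, 0, hH0⟩⟩
  obtain ⟨x, hx, hxH⟩ :=
    (IsometricContinuousFunctionalCalculus.isGreatest_norm_spectrum (𝕜 := ℝ) H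
      hH.isSelfAdjoint).1
  rw [hH.spectrum_real_eq_range_eigenvalues] at hx
  obtain ⟨i, rfl⟩ := hx
  have hle (s : ℝ) : Real.exp (s * hH.eigenvalues i) ≤ (exp (s • H)).trace := by
    rw [trace_exp_smul_eq_sum hH]
    exact Finset.single_le_sum (f := fun i ↦ Real.exp (s * hH.eigenvalues i))
      (fun _ _ ↦ (Real.exp_pos _).le) (Finset.mem_univ i)
  have hpos (s : ℝ) : 0 ≤ (exp (s • H)).trace := (Real.exp_pos _).le.trans (hle s)
  simp only [Real.norm_eq_abs] at hxH
  rcases abs_choice (hH.eigenvalues i) with h | h <;> rw [← hxH, h]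
  · exact (hle t).trans (le_add_of_nonneg_right (hpos _))
  · rw [mul_neg, ← neg_mul]
    exact (hle (-t)).trans (le_add_of_nonneg_left (hpos _))

end ExponentialMoment

/-! ### Hermitian dilation -/

section Dilation

variable {m n : Type*}

/-- The Hermitian dilation `[[0, A], [Aᵀ, 0]]` of a rectangular real matrix `A`, as a linear map
in `A`. -/
def hermitianDilation : Matrix m n ℝ →ₗ[ℝ] Matrix (m ⊕ n) (m ⊕ n) ℝ where
  toFun A := Matrix.fromBlocks 0 A A.conjTranspose 0
  map_add' A B := by simp [Matrix.fromBlocks_add]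
  map_smul' r A := by simp [Matrix.fromBlocks_smul]

theorem isHermitian_hermitianDilation (A : Matrix m n ℝ) : (hermitianDilation A).IsHermitian :=
  Matrix.isHermitian_fromBlocks_iff.2 (by simp)

variable [Fintype m] [Fintype n] [DecidableEq n]

theorem sum_sq_mulVec_le (A : Matrix m n ℝ) (x : n → ℝ) :
    ∑ i, (A.mulVec x i) ^ 2 ≤ ‖A‖ ^ 2 * ∑ j, x j ^ 2 := by
  have h := A.l2_opNorm_mulVec (WithLp.toLp 2 x)
  rw [← sq_le_sq₀ (norm_nonneg _) (by positivity), mul_pow, EuclideanSpace.norm_sq_eq,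
    EuclideanSpace.norm_sq_eq] at h
  simpa using h

theorem norm_le_of_sum_sq_mulVec_le (A : Matrix m n ℝ) {C : ℝ} (hC : 0 ≤ C)
    (h : ∀ x : n → ℝ, ∑ i, (A.mulVec x i) ^ 2 ≤ C ^ 2 * ∑ j, x j ^ 2) : ‖A‖ ≤ C := by
  rw [Matrix.l2_opNorm_def]
  refine ContinuousLinearMap.opNorm_le_bound _ hC fun x ↦ ?_
  rw [← sq_le_sq₀ (norm_nonneg _) (by positivity), mul_pow, EuclideanSpace.norm_sq_eq,
    EuclideanSpace.norm_sq_eq]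
  simpa using h x

theorem norm_hermitianDilation [DecidableEq m] (A : Matrix m n ℝ) : ‖hermitianDilation A‖ = ‖A‖ := by
  have hmul (x : m ⊕ n → ℝ) : (hermitianDilation A).mulVec x =
      Sum.elim (A.mulVec (x ∘ Sum.inr)) (A.conjTranspose.mulVec (x ∘ Sum.inl)) := by
    conv_lhs => rw [← Sum.elim_comp_inl_inr x]
    simp [hermitianDilation, Matrix.fromBlocks_mulVec]
  apply le_antisymm
  · refine norm_le_of_sum_sq_mulVec_le _ (norm_nonneg _) fun x ↦ ?_
    have h₁ := sum_sq_mulVec_le A (x ∘ Sum.inr)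
    have h₂ := sum_sq_mulVec_le A.conjTranspose (x ∘ Sum.inl)
    rw [Matrix.l2_opNorm_conjTranspose] at h₂
    simp only [hmul, Fintype.sum_sum_type, Sum.elim_inl, Sum.elim_inr, Function.comp_apply]
      at h₁ h₂ ⊢
    linarith
  · refine norm_le_of_sum_sq_mulVec_le _ (norm_nonneg _) fun x ↦ ?_
    have h := sum_sq_mulVec_le (hermitianDilation A) (Sum.elim 0 x)
    simpa [hmul] using h

end Dilation

/-! ### Extending and restricting injections -/

section Embeddings

/-- Each injection `Fin k ↪ Fin N` has exactly `N - k` extensions to `Fin (k + 1) ↪ Fin N` that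
insert a new entry at a prescribed position `j`. -/
theorem sum_succAboveEmb_trans {k N : ℕ} (f : (Fin k ↪ Fin N) → ℝ) (j : Fin (k + 1)) :
    ∑ g : Fin (k + 1) ↪ Fin N, f ((Fin.succAboveEmb j).trans g) =
      ((N - k : ℕ) : ℝ) * ∑ e, f e := by
  classical
  -- Permuting positions by the cycle that moves `j` to `0` reduces to the case `j = 0`.
  have hj : ∑ g : Fin (k + 1) ↪ Fin N, f ((Fin.succAboveEmb j).trans g) =
      ∑ g : Fin (k + 1) ↪ Fin N, f ((Fin.succEmb k).trans g) := by
    refine Fintype.sum_equiv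
      (Equiv.embeddingCongr (Fin.cycleRange j) (Equiv.refl (Fin N))) _ _ fun g ↦ ?_
    congr 1
    ext i
    simp [Equiv.embeddingCongr, Fin.cycleRange_symm_succ]
  rw [hj]
  -- Restricting along `Fin.succ` fibres the injections over their restrictions.
  have h₂ : ∑ g : Fin (k + 1) ↪ Fin N, f ((Fin.succEmb k).trans g) =
      ∑ p : (Σ e : Fin k ↪ Fin N, {i // i ∉ Set.range e}), f p.1 :=
    Fintype.sum_equiv (Equiv.embeddingFinSucc k (Fin N)) _ _ fun g ↦ rfl
  rw [h₂, Fintype.sum_sigma, Finset.mul_sum]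
  refine Finset.sum_congr rfl fun e _ ↦ ?_
  have hcard : Fintype.card {i // i ∉ Set.range e} = N - k := by
    rw [Fintype.card_subtype_compl, Fintype.card_fin,
      ← Fintype.card_congr (Equiv.ofInjective e e.injective), Fintype.card_fin]
  change ∑ _ : {i // i ∉ Set.range e}, f e = _
  rw [Finset.sum_const, Finset.card_univ, hcard, nsmul_eq_mul]

end Embeddings

/-! ### The reverse martingale of sample means -/

section SampleMean

variable {d₁ d₂ N : ℕ}

/-- The sample mean of the population `A` over the indices `e`, minus the population mean. -/
noncomputable def sampleDeviation (A : Fin N → Matrix (Fin d₁) (Fin d₂) ℝ) {k : ℕ}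
    (e : Fin k → Fin N) : Matrix (Fin d₁) (Fin d₂) ℝ :=
  (1 / (k : ℝ)) • ∑ i, A (e i) - (1 / (N : ℝ)) • ∑ i, A i

variable (A : Fin N → Matrix (Fin d₁) (Fin d₂) ℝ)

/-- The increment of the sample mean when the `j`-th of `k + 1` sampled items is removed. -/
noncomputable def removalIncrement {k : ℕ} (g : Fin (k + 1) → Fin N) (j : Fin (k + 1)) :
    Matrix (Fin d₁) (Fin d₂) ℝ :=
  (1 / (k : ℝ)) • ((1 / ((k + 1 : ℕ) : ℝ)) • ∑ i, A (g i) - A (g j))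

/-- Here `k ≠ 0` is needed, as the mean of an empty sample is the junk value `0`. -/
theorem sampleDeviation_comp_succAbove {k : ℕ} (hk : k ≠ 0) (g : Fin (k + 1) → Fin N)
    (j : Fin (k + 1)) :
    sampleDeviation A (g ∘ j.succAbove) = sampleDeviation A g + removalIncrement A g j := by
  have hk' : (k : ℝ) ≠ 0 := Nat.cast_ne_zero.2 hk
  have hk1 : (k : ℝ) + 1 ≠ 0 := by positivity
  have hsum : ∑ i, A (g (j.succAbove i)) = ∑ i, A (g i) - A (g j) := by
    rw [Fin.sum_univ_succAbove (fun i ↦ A (g i)) j]; abel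
  simp only [sampleDeviation, removalIncrement, Function.comp_apply, hsum]
  push_cast
  match_scalars <;> field_simp

theorem sum_removalIncrement {k : ℕ} (g : Fin (k + 1) → Fin N) :
    ∑ j, removalIncrement A g j = 0 := by
  have hk1 : (k : ℝ) + 1 ≠ 0 := by positivity
  simp only [removalIncrement, ← Finset.smul_sum, Finset.sum_sub_distrib, Finset.sum_const,
    Finset.card_univ, Fintype.card_fin, ← Nat.cast_smul_eq_nsmul ℝ, smul_smul]
  push_cast
  rw [one_div_mul_cancel hk1, one_smul, sub_self, smul_zero]

variable {A} in
theorem norm_removalIncrement_le {σ : ℝ} (hA : ∀ i, ‖A i‖ ≤ σ) {k : ℕ}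
    (g : Fin (k + 1) → Fin N) (j : Fin (k + 1)) :
    ‖removalIncrement A g j‖ ≤ 2 * σ / k := by
  have hk1 : (0 : ℝ) < k + 1 := by positivity
  have hsum : ‖∑ i, A (g i)‖ ≤ (k + 1) * σ :=
    (norm_sum_le_of_le _ fun i _ ↦ hA (g i)).trans_eq (by simp)
  have hmean : ‖(1 / ((k + 1 : ℕ) : ℝ)) • ∑ i, A (g i)‖ ≤ σ := by
    rw [norm_smul, Real.norm_of_nonneg (by positivity)]
    push_cast
    rw [one_div, inv_mul_le_iff₀ hk1]
    exact hsum
  rw [removalIncrement, norm_smul, Real.norm_of_nonneg (by positivity), one_div, inv_mul_eq_div]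
  gcongr
  linarith [norm_sub_le ((1 / ((k + 1 : ℕ) : ℝ)) • ∑ i, A (g i)) (A (g j)), hA (g j)]

open NormedSpace

/-- The trace exponential moment `∑ tr exp (θ H(Y))`, where `H` is the Hermitian dilation and `Y`
runs over the deviations of all ordered samples of size `k`. It is not normalised by the number
`N.descFactorial k` of samples. -/
noncomputable def traceExpMoment (θ : ℝ) (k : ℕ) : ℝ :=
  ∑ e : Fin k ↪ Fin N, (exp (θ • hermitianDilation (sampleDeviation A e))).trace

variable {A} in
/-- One step of the reverse martingale: passing from a sample of size `k + 1` to a uniformly random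
subsample of size `k` changes the mean by a centred increment of norm at most `2 σ / k`. -/
theorem traceExpMoment_le_succ {σ : ℝ} (hA : ∀ i, ‖A i‖ ≤ σ) (θ : ℝ) {k : ℕ} (hk : k ≠ 0) :
    ((N - k : ℕ) : ℝ) * traceExpMoment A θ k ≤
      Real.exp (2 * θ ^ 2 * σ ^ 2 / k ^ 2) * traceExpMoment A θ (k + 1) := by
  have hk1 : (0 : ℝ) < k + 1 := by positivity
  let f : (Fin k ↪ Fin N) → ℝ := fun e ↦
    (exp (θ • hermitianDilation (sampleDeviation A e))).trace
  have hg (g : Fin (k + 1) ↪ Fin N) :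
      ∑ j : Fin (k + 1), f ((Fin.succAboveEmb j).trans g) ≤
        (k + 1) * (Real.exp (2 * θ ^ 2 * σ ^ 2 / k ^ 2) *
          (exp (θ • hermitianDilation (sampleDeviation A g))).trace) := by
    have h := sum_trace_exp_add_le
      (H := θ • hermitianDilation (sampleDeviation A g))
      (isHermitian_smul θ (isHermitian_hermitianDilation _))
      (D := fun j ↦ θ • hermitianDilation (removalIncrement A g j))
      (fun j ↦ isHermitian_smul θ (isHermitian_hermitianDilation _))
      (by rw [← Finset.smul_sum, ← map_sum, sum_removalIncrement, map_zero, smul_zero])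
      (c := |θ| * (2 * σ / k))
      (fun j ↦ by
        rw [norm_smul, norm_hermitianDilation, Real.norm_eq_abs]
        gcongr
        exact norm_removalIncrement_le hA g j)
    have hc : (|θ| * (2 * σ / k)) ^ 2 / 2 = 2 * θ ^ 2 * σ ^ 2 / k ^ 2 := by
      rw [mul_pow, sq_abs]; ring
    rw [hc, Fintype.card_fin] at h
    push_cast at h
    refine le_trans (le_of_eq ?_) h
    refine Finset.sum_congr rfl fun j _ ↦ ?_
    rw [← smul_add, ← map_add, ← sampleDeviation_comp_succAbove A hk]
    rfl
  have h : (k + 1 : ℝ) * (((N - k : ℕ) : ℝ) * traceExpMoment A θ k) ≤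
      (k + 1) * (Real.exp (2 * θ ^ 2 * σ ^ 2 / k ^ 2) * traceExpMoment A θ (k + 1)) := by
    calc (k + 1 : ℝ) * (((N - k : ℕ) : ℝ) * traceExpMoment A θ k)
        = ∑ j : Fin (k + 1), ∑ g : Fin (k + 1) ↪ Fin N,
            f ((Fin.succAboveEmb j).trans g) := by
          simp only [sum_succAboveEmb_trans f]
          rw [Finset.sum_const, Finset.card_univ, Fintype.card_fin, nsmul_eq_mul, Nat.cast_succ]
          rfl
      _ = ∑ g : Fin (k + 1) ↪ Fin N, ∑ j : Fin (k + 1),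
            f ((Fin.succAboveEmb j).trans g) := Finset.sum_comm
      _ ≤ _ := by
          rw [traceExpMoment, Finset.mul_sum, Finset.mul_sum]
          exact Finset.sum_le_sum fun g _ ↦ hg g
  exact le_of_mul_le_mul_left h hk1

/-- A sample of the whole population has deviation zero. -/
theorem sampleDeviation_perm (e : Fin N ↪ Fin N) : sampleDeviation A e = 0 := by
  have he : Function.Bijective e := Finite.injective_iff_bijective.1 e.injective
  rw [sampleDeviation, he.sum_comp A, sub_self]

/-- The inductive step showing that `(1 + 1 / k) (1 - k / N) / k` dominates
`∑_{k ≤ i < N} 1 / i ^ 2`; it vanishes at `k = N`. -/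
theorem inv_sq_add_varianceProxy_succ_le {k N : ℕ} (hk : k ≠ 0) (hkN : k < N) :
    1 / (k : ℝ) ^ 2 + (1 + 1 / ((k + 1 : ℕ) : ℝ)) * (1 - ((k + 1 : ℕ) : ℝ) / N) / (k + 1 : ℕ) ≤
      (1 + 1 / (k : ℝ)) * (1 - (k : ℝ) / N) / k := by
  have hk' : (0 : ℝ) < k := by positivity
  have hN : (k : ℝ) + 1 ≤ N := by exact_mod_cast hkN
  have hN0 : (0 : ℝ) < N := by linarith
  rw [← sub_nonneg]
  push_cast
  have : (1 + 1 / (k : ℝ)) * (1 - (k : ℝ) / N) / k -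
      (1 / (k : ℝ) ^ 2 + (1 + 1 / ((k : ℝ) + 1)) * (1 - ((k : ℝ) + 1) / N) / (k + 1)) =
      (N - k - 1) / (k * (k + 1) ^ 2 * N) := by
    field_simp
    ring
  rw [this]
  exact div_nonneg (by linarith) (by positivity)

variable {A} in
theorem traceExpMoment_le {σ : ℝ} (hA : ∀ i, ‖A i‖ ≤ σ) (θ : ℝ) {k : ℕ} (hk : k ≠ 0)
    (hkN : k ≤ N) :
    traceExpMoment A θ k ≤ N.descFactorial k * ((d₁ + d₂) *
      Real.exp (2 * θ ^ 2 * σ ^ 2 * ((1 + 1 / (k : ℝ)) * (1 - (k : ℝ) / N) / k))) := by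
  induction hkN using Nat.decreasingInduction with
  | self =>
    have hN : (N : ℝ) ≠ 0 := Nat.cast_ne_zero.2 hk
    simp [traceExpMoment, sampleDeviation_perm, hN, Fintype.card_embedding_eq, mul_add]
  | of_succ k hkN ih =>
    have ih := ih k.succ_ne_zero
    have hpos : (0 : ℝ) < ((N - k : ℕ) : ℝ) := by exact_mod_cast Nat.sub_pos_of_lt hkN
    refine le_of_mul_le_mul_left ((traceExpMoment_le_succ hA θ hk).trans ?_) hpos
    refine (mul_le_mul_of_nonneg_left ih (Real.exp_pos _).le).trans ?_
    rw [Nat.descFactorial_succ, Nat.cast_mul]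
    have hexp : Real.exp (2 * θ ^ 2 * σ ^ 2 / k ^ 2) *
        Real.exp (2 * θ ^ 2 * σ ^ 2 *
          ((1 + 1 / ((k + 1 : ℕ) : ℝ)) * (1 - ((k + 1 : ℕ) : ℝ) / N) / (k + 1 : ℕ))) ≤
        Real.exp (2 * θ ^ 2 * σ ^ 2 * ((1 + 1 / (k : ℝ)) * (1 - (k : ℝ) / N) / k)) := by
      rw [← Real.exp_add, Real.exp_le_exp, ← mul_one_div (2 * θ ^ 2 * σ ^ 2), ← mul_add]
      exact mul_le_mul_of_nonneg_left (inv_sq_add_varianceProxy_succ_le hk hkN) (by positivity)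
    calc _ = ((N - k : ℕ) : ℝ) * (N.descFactorial k * ((d₁ + d₂) *
          (Real.exp (2 * θ ^ 2 * σ ^ 2 / k ^ 2) * Real.exp (2 * θ ^ 2 * σ ^ 2 *
          ((1 + 1 / ((k + 1 : ℕ) : ℝ)) * (1 - ((k + 1 : ℕ) : ℝ) / N) / (k + 1 : ℕ)))))) := by
          ring
      _ ≤ _ := by gcongr

end SampleMean

/-! ### From sampling probabilities to averages over injections -/

section Probability

/-- Almost surely a sample without replacement is one of the finitely many injective sequences, so
the probability of an event is at most the proportion of such sequences satisfying it. -/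
theorem IsSampleWithoutReplacement.measureReal_le {Ω : Type*} [MeasurableSpace Ω] {P : Measure Ω}
    [IsProbabilityMeasure P] {N n : ℕ} (hnN : n ≤ N) {J : Fin n → Ω → Fin N}
    (hJ : IsSampleWithoutReplacement P J) (p : (Fin n → Fin N) → Prop)
    {φ : (Fin n ↪ Fin N) → ℝ} (hφ₀ : ∀ e, 0 ≤ φ e) (hφ : ∀ e : Fin n ↪ Fin N, p e → 1 ≤ φ e) :
    P.real {ω | p fun i ↦ J i ω} ≤ (∑ e, φ e) / N.descFactorial n := by
  classical
  have hD : (0 : ℝ) < N.descFactorial n := by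
    exact_mod_cast Nat.pos_of_ne_zero (by rw [Ne, Nat.descFactorial_eq_zero_iff_lt]; omega)
  have hmeas (f : Fin n → Fin N) : MeasurableSet {ω | ∀ i, J i ω = f i} := by
    rw [Set.ofPred_forall]
    exact MeasurableSet.iInter fun i ↦ hJ.measurable i (measurableSet_singleton (f i))
  have hreal (e : Fin n ↪ Fin N) : P.real {ω | ∀ i, J i ω = e i} = (N.descFactorial n : ℝ)⁻¹ := by
    rw [measureReal_def, hJ.prob_eq, ENNReal.toReal_inv, ENNReal.toReal_natCast]
  have hunion : P.real (⋃ e : Fin n ↪ Fin N, {ω | ∀ i, J i ω = e i}) = 1 := by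
    rw [measureReal_iUnion_fintype ?_ fun e : Fin n ↪ Fin N ↦ hmeas e]
    · simp [hreal, Fintype.card_embedding_eq, hD.ne']
    · intro e e' hee
      refine Set.disjoint_left.2 fun ω h h' ↦ hee ?_
      ext i
      rw [← h i, ← h' i]
  have hnull : P.real (⋃ e : Fin n ↪ Fin N, {ω | ∀ i, J i ω = e i})ᶜ = 0 := by
    rw [probReal_compl_eq_one_sub (MeasurableSet.iUnion fun e : Fin n ↪ Fin N ↦ hmeas e), hunion, sub_self]
  have hsub : {ω | p fun i ↦ J i ω} ⊆
      (⋃ e ∈ Finset.univ.filter fun e : Fin n ↪ Fin N ↦ p e, {ω | ∀ i, J i ω = e i}) ∪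
        (⋃ e : Fin n ↪ Fin N, {ω | ∀ i, J i ω = e i})ᶜ := by
    intro ω hω
    by_cases h : ω ∈ ⋃ e : Fin n ↪ Fin N, {ω | ∀ i, J i ω = e i}
    · obtain ⟨e, he⟩ := Set.mem_iUnion.1 h
      have hp : p e := by
        have : (fun i ↦ J i ω) = e := funext he
        rwa [← this]
      exact Or.inl (Set.mem_iUnion₂.2 ⟨e, by simpa using hp, he⟩)
    · exact Or.inr h
  calc P.real {ω | p fun i ↦ J i ω}
      ≤ _ := (measureReal_mono hsub).trans (measureReal_union_le _ _)
    _ ≤ ∑ e ∈ Finset.univ.filter fun e : Fin n ↪ Fin N ↦ p e,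
          P.real {ω | ∀ i, J i ω = e i} := by
        rw [hnull, add_zero]
        exact measureReal_biUnion_finset_le _ _
    _ = ∑ e ∈ Finset.univ.filter fun e : Fin n ↪ Fin N ↦ p e, 1 * (N.descFactorial n : ℝ)⁻¹ := by
        simp only [hreal, one_mul]
    _ ≤ ∑ e ∈ Finset.univ.filter fun e : Fin n ↪ Fin N ↦ p e, φ e * (N.descFactorial n : ℝ)⁻¹ :=
        Finset.sum_le_sum fun e he ↦ by
          gcongr
          exact hφ e (Finset.mem_filter.1 he).2
    _ ≤ ∑ e, φ e * (N.descFactorial n : ℝ)⁻¹ :=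
        Finset.sum_le_sum_of_subset_of_nonneg (Finset.filter_subset _ _) fun e _ _ ↦
          mul_nonneg (hφ₀ e) (by positivity)
    _ = _ := by rw [← Finset.sum_mul, div_eq_mul_inv]

end Probability

/-! ### The tail bound -/

theorem theorem4 {Ω : Type*} [MeasurableSpace Ω] (P : Measure Ω) [IsProbabilityMeasure P]
    (d₁ d₂ N n : ℕ) (hn : 1 ≤ n) (hnN : n < N)
    (A : Fin N → Matrix (Fin d₁) (Fin d₂) ℝ) (σ : ℝ) (hσ : 0 < σ) (hA : ∀ i, ‖A i‖ ≤ σ)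
    (J : Fin n → Ω → Fin N) (hJ : IsSampleWithoutReplacement P J)
    (ε : ℝ) (hε : 0 < ε) :
    P.real {ω | ‖(1 / (n : ℝ)) • ∑ i, A (J i ω) - (1 / (N : ℝ)) • ∑ i, A i‖ ≥ ε} ≤
      2 * ((d₁ : ℝ) + (d₂ : ℝ)) *
        Real.exp (-(((n : ℝ) * ε ^ 2) /
          (8 * σ ^ 2 * (1 + 1 / (n : ℝ)) * (1 - (n : ℝ) / (N : ℝ))))) := by
  have hn0 : n ≠ 0 := by omega
  have hn' : (0 : ℝ) < n := by exact_mod_cast hn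
  have hN' : (0 : ℝ) < N := by exact_mod_cast (by omega : 0 < N)
  have hD : (0 : ℝ) < N.descFactorial n := by
    exact_mod_cast Nat.pos_of_ne_zero (by rw [Ne, Nat.descFactorial_eq_zero_iff_lt]; omega)
  set v : ℝ := (1 + 1 / (n : ℝ)) * (1 - (n : ℝ) / N) / n with hv
  have hfrac : 0 < 1 - (n : ℝ) / N := by
    rw [sub_pos, div_lt_one hN']
    exact_mod_cast hnN
  have hv0 : 0 < v := by positivity
  -- The minimiser of `-θ * ε + 2 * θ ^ 2 * σ ^ 2 * v`.
  set θ : ℝ := ε / (4 * σ ^ 2 * v) with hθ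
  have hθ0 : 0 < θ := by positivity
  have hexpo : -(θ * ε) + 2 * θ ^ 2 * σ ^ 2 * v =
      -((n * ε ^ 2) / (8 * σ ^ 2 * (1 + 1 / (n : ℝ)) * (1 - (n : ℝ) / N))) := by
    have h8 : 8 * σ ^ 2 * (1 + 1 / (n : ℝ)) * (1 - (n : ℝ) / N) = 8 * σ ^ 2 * (v * n) := by
      rw [hv]; field_simp
    rw [h8, hθ]
    field_simp
    ring
  let φ : (Fin n ↪ Fin N) → ℝ := fun e ↦ Real.exp (-(θ * ε)) *
    ((NormedSpace.exp (θ • hermitianDilation (sampleDeviation A e))).trace +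
      (NormedSpace.exp ((-θ) • hermitianDilation (sampleDeviation A e))).trace)
  have hmarkov := hJ.measureReal_le hnN.le (fun f ↦ ε ≤ ‖sampleDeviation A f‖) (φ := φ)
    (fun e ↦ mul_nonneg (Real.exp_pos _).le (add_nonneg
      (posSemidef_exp (isHermitian_smul _ (isHermitian_hermitianDilation _))).trace_nonneg
      (posSemidef_exp (isHermitian_smul _ (isHermitian_hermitianDilation _))).trace_nonneg))
    (fun e he ↦ by
      have hne : hermitianDilation (sampleDeviation A e) ≠ 0 := by
        rw [← norm_pos_iff, norm_hermitianDilation]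
        exact hε.trans_le he
      have h := exp_mul_norm_le_trace_exp_add (isHermitian_hermitianDilation _) hne θ
      rw [norm_hermitianDilation] at h
      have h1 : Real.exp (-(θ * ε)) * Real.exp (θ * ε) = 1 := by
        rw [← Real.exp_add, neg_add_cancel, Real.exp_zero]
      rw [← h1]
      refine mul_le_mul_of_nonneg_left (le_trans ?_ h) (Real.exp_pos _).le
      rw [Real.exp_le_exp]
      exact mul_le_mul_of_nonneg_left he hθ0.le)
  refine hmarkov.trans ?_
  rw [div_le_iff₀ hD, ← hexpo, Real.exp_add]
  have h₁ := traceExpMoment_le hA θ hn0 hnN.le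
  have h₂ := traceExpMoment_le hA (-θ) hn0 hnN.le
  rw [neg_sq] at h₂
  calc ∑ e, φ e = Real.exp (-(θ * ε)) * (traceExpMoment A θ n + traceExpMoment A (-θ) n) := by
        simp only [φ, traceExpMoment, ← Finset.mul_sum, Finset.sum_add_distrib]
    _ ≤ Real.exp (-(θ * ε)) * (N.descFactorial n * ((d₁ + d₂) *
          Real.exp (2 * θ ^ 2 * σ ^ 2 * v)) + N.descFactorial n * ((d₁ + d₂) *
          Real.exp (2 * θ ^ 2 * σ ^ 2 * v))) :=
        mul_le_mul_of_nonneg_left (add_le_add h₁ h₂) (Real.exp_pos _).le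
    _ = _ := by ring
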